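/- Let $M$ be a compact connected smooth manifold (without boundary) of real dimension $2n$, with an almost complex structure $J$ and a parallelism $\{v_1,w_1,\dots,v_n,w_n\}$ (a global smooth frame of $TM$) such that $Jv_i=w_i$ and $Jw_i=-v_i$ for all $i$. Let $\{v^i,w^i\}$ be the dual coframe, and put $\mathcal X_i=\frac12(v_i-\mathrm{i}\,w_i)$ and $\varphi^i=v^i+\mathrm{i}\,w^i$. Let $\bar\partial\varphi^i$ be the $(1,1)$-component of $d\varphi^i$, let the smooth complex functions $\lambda^i_{jk}$ be defined by $$\bar\partial\varphi^i=\sum_{j,k=1}^n\lambda^i_{jk}\,\varphi^j\wedge\bar\varphi^k ,$$ and set $$\alpha_k=\sum_{i=1}^n\lambda^i_{ik},\qquad \beta=\sum_{k=1}^n\Bigl(\mathcal X_k(\alpha_k)+\sum_{i=1}^n\lambda^i_{kk}\bar\alpha_i\Bigr).$$ For an integer $m\ge 1$ define the second order operator $$L_m(f)=\sum_{k=1}^n\Bigl(v_k(v_k(f))+w_k(w_k(f))-4m\,\mathrm{Re}(\alpha_k)\,v_k(f)-4m\,\mathrm{Im}(\alpha_k)\,w_k(f)-2\sum_{i=1}^n\mathrm{Re}(\lambda^i_{kk})\,v_i(f)-2\sum_{i=1}^n\mathrm{Im}(\lambda^i_{kk})\,w_i(f)\Bigr)$$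 and the function $$q_m=\mathrm{Re}\sum_{k=1}^n\Bigl(\mathcal X_k(\alpha_k)-m|\alpha_k|^2-\sum_{i=1}^n\lambda^i_{kk}\bar\alpha_i\Bigr).$$ Suppose that $\beta$ is real valued and that, at every point of $M$, $$\mathrm{Re}\sum_{k=1}^n\Bigl(\mathcal X_k(\alpha_k)-\sum_{i=1}^n\lambda^i_{kk}\bar\alpha_i\Bigr)\ \ge\ m\sum_{k=1}^n|\alpha_k|^2 .$$ Then for every pair of real valued $C^2$ (in particular, smooth) functions $u,v$ on $M$ that satisfy $$\begin{cases} L_m(v)-4m\,q_m\,v-4m\,\mathrm{Im}(\beta)\,u=0,\\ -L_m(u)+4m\,q_m\,u-4m\,\mathrm{Im}(\beta)\,v=0,\end{cases}$$ both $u$ and $v$ are constant. -/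

import Mathlib

open scoped Manifold ContDiff
open Bundle

noncomputable section

namespace AlmostComplexPDE

/-- A (smooth) almost complex structure on `M`: a smooth endomorphism `J` of the tangent bundle,
i.e. a smooth section of `Hom(TM, TM)`, with `J² = -id`. -/
structure AlmostComplexStructure {E H : Type*} [NormedAddCommGroup E] [NormedSpace ℝ E]
    [TopologicalSpace H] (I : ModelWithCorners ℝ E H)
    (M : Type*) [TopologicalSpace M] [ChartedSpace H M] [IsManifold I ∞ M] where
  /-- the endomorphism of each tangent space -/
  J : ∀ x : M, TangentSpace I x →L[ℝ] TangentSpace I x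
  sq : ∀ (x : M) (X : TangentSpace I x), J x (J x X) = -X
  smooth : ContMDiff I (I.prod 𝓘(ℝ, E →L[ℝ] E)) ∞
    (fun x : M => TotalSpace.mk' (E →L[ℝ] E)
      (E := fun x : M => TangentSpace I x →L[ℝ] TangentSpace I x) x (J x))

/-- A parallelism `{v₁, w₁, …, vₙ, wₙ}` of `M` (a global smooth frame of the tangent bundle) in
which the almost complex structure is in standard form: `J vᵢ = wᵢ`, `J wᵢ = -vᵢ`. -/
structure AdaptedParallelism {E H : Type*} [NormedAddCommGroup E] [NormedSpace ℝ E]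
    [TopologicalSpace H] {I : ModelWithCorners ℝ E H}
    {M : Type*} [TopologicalSpace M] [ChartedSpace H M] [IsManifold I ∞ M]
    (𝒥 : AlmostComplexStructure I M) (n : ℕ) where
  /-- the vector fields `vᵢ` -/
  v : Fin n → ∀ x : M, TangentSpace I x
  /-- the vector fields `wᵢ` -/
  w : Fin n → ∀ x : M, TangentSpace I x
  isFrame : IsLocalFrameOn I E ∞ (V := fun x : M => TangentSpace I x)
    (Sum.elim v w : Fin n ⊕ Fin n → ∀ x : M, TangentSpace I x) Set.univ
  J_v : ∀ i x, 𝒥.J x (v i x) = w i x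
  J_w : ∀ i x, 𝒥.J x (w i x) = -v i x

section Calculus

variable {E H : Type*} [NormedAddCommGroup E] [NormedSpace ℝ E]
  [TopologicalSpace H] (I : ModelWithCorners ℝ E H)
  {M : Type*} [TopologicalSpace M] [ChartedSpace H M]

/-- The derivative `X(f)` of a function `f` (with values in a real normed space, here `ℝ` or `ℂ`)
along a real vector field `X`. -/
def dirDeriv {F : Type*} [NormedAddCommGroup F] [NormedSpace ℝ F]
    (X : ∀ x : M, TangentSpace I x) (f : M → F) : M → F :=
  fun x => mvfderiv I f x (X x)

/-- The exterior derivative of a complex valued `1`-form `θ`, evaluated on a pair of real vector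
fields: `dθ(X, Y) = X(θ(Y)) - Y(θ(X)) - θ([X, Y])`. -/
def extDer (θ : ∀ x : M, TangentSpace I x →ₗ[ℝ] ℂ) (X Y : ∀ x : M, TangentSpace I x) : M → ℂ :=
  fun x => dirDeriv I X (fun y => θ y (Y y)) x - dirDeriv I Y (fun y => θ y (X y)) x
    - θ x (VectorField.mlieBracket I X Y x)

/-- The wedge product of two complex valued covectors, evaluated on a pair of vectors:
`(θ ∧ η)(X, Y) = θ(X) η(Y) - θ(Y) η(X)`. -/
def wedge {x : M} (θ η : TangentSpace I x →ₗ[ℝ] ℂ) (X Y : TangentSpace I x) : ℂ :=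
  θ X * η Y - θ Y * η X

/-- The complex conjugate of a complex valued covector. -/
def conjForm {x : M} (θ : TangentSpace I x →ₗ[ℝ] ℂ) : TangentSpace I x →ₗ[ℝ] ℂ :=
  Complex.conjAe.toLinearMap ∘ₗ θ

/-- `∂̄θ` for a complex valued form `θ` of type `(1, 0)`, evaluated on a pair of real vector fields:
it is the `(1, 1)`-component of `dθ`. Since a form of type `(1, 1)` is `J`-invariant while
forms of type `(2, 0)` and `(0, 2)` change sign under `(X, Y) ↦ (JX, JY)`, this component
is `(X, Y) ↦ (dθ(X, Y) + dθ(JX, JY)) / 2`. -/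
def delbar {I : ModelWithCorners ℝ E H} [IsManifold I ∞ M] (𝒥 : AlmostComplexStructure I M)
    (θ : ∀ x : M, TangentSpace I x →ₗ[ℝ] ℂ) (X Y : ∀ x : M, TangentSpace I x) : M → ℂ :=
  fun x => (extDer I θ X Y x + extDer I θ (fun y => 𝒥.J y (X y)) (fun y => 𝒥.J y (Y y)) x) / 2

theorem extDer_swap (θ : ∀ x : M, TangentSpace I x →ₗ[ℝ] ℂ) (X Y : ∀ x : M, TangentSpace I x)
    (x : M) : extDer I θ Y X x = - extDer I θ X Y x := by
  simp only [extDer, VectorField.mlieBracket_swap_apply (V := Y), map_neg]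
  ring

end Calculus

namespace AdaptedParallelism

variable {E H : Type*} [NormedAddCommGroup E] [NormedSpace ℝ E]
  [TopologicalSpace H] {I : ModelWithCorners ℝ E H}
  {M : Type*} [TopologicalSpace M] [ChartedSpace H M] [IsManifold I ∞ M]
  {𝒥 : AlmostComplexStructure I M} {n : ℕ} (P : AdaptedParallelism 𝒥 n)

/-- The dual `1`-forms `vⁱ`. -/
def vDual (i : Fin n) (x : M) : TangentSpace I x →ₗ[ℝ] ℝ := P.isFrame.coeff (Sum.inl i) x

/-- The dual `1`-forms `wⁱ`. -/
def wDual (i : Fin n) (x : M) : TangentSpace I x →ₗ[ℝ] ℝ := P.isFrame.coeff (Sum.inr i) x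

/-- The coframe of `(1, 0)`-forms `φⁱ = vⁱ + i wⁱ`. -/
def phi (i : Fin n) (x : M) : TangentSpace I x →ₗ[ℝ] ℂ :=
  Complex.ofRealCLM.toLinearMap ∘ₗ P.vDual i x
    + Complex.I • (Complex.ofRealCLM.toLinearMap ∘ₗ P.wDual i x)

/-- The action `𝒳ₖ(f) = (vₖ(f) - i wₖ(f)) / 2` on complex functions of the `(1, 0)` vector field
`𝒳ₖ = (vₖ - i wₖ) / 2`. -/
def cX (k : Fin n) (f : M → ℂ) : M → ℂ :=
  fun x => (dirDeriv I (P.v k) f x - Complex.I * dirDeriv I (P.w k) f x) / 2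

/-- The structure functions `λⁱⱼₖ`, i.e. the coefficients in
`∂̄φⁱ = ∑ⱼₖ λⁱⱼₖ φʲ ∧ φ̄ᵏ` (see `delbar_phi_frame`). Explicitly `λⁱⱼₖ = ∂̄φⁱ(𝒳ⱼ, 𝒳̄ₖ)`, where `∂̄φⁱ` is
extended complex bilinearly to `𝒳ⱼ = (vⱼ - i wⱼ) / 2` and `𝒳̄ₖ = (vₖ + i wₖ) / 2`. -/
def lam (i j k : Fin n) : M → ℂ := fun x =>
  (delbar 𝒥 (P.phi i) (P.v j) (P.v k) x + Complex.I * delbar 𝒥 (P.phi i) (P.v j) (P.w k) x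
    - Complex.I * delbar 𝒥 (P.phi i) (P.w j) (P.v k) x
    + delbar 𝒥 (P.phi i) (P.w j) (P.w k) x) / 4

/-- `αₖ = ∑ᵢ λⁱᵢₖ`, so that `∂̄(φ¹ ∧ … ∧ φⁿ) = α ⊗ (φ¹ ∧ … ∧ φⁿ)` with `α = -∑ₖ αₖ φ̄ᵏ`. -/
def alpha (k : Fin n) : M → ℂ := fun x => ∑ i, P.lam i i k x

/-- `β = ∑ₖ (𝒳ₖ(αₖ) + ∑ᵢ λⁱₖₖ ᾱᵢ)`. -/
def beta : M → ℂ := fun x =>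
  ∑ k, (P.cX k (P.alpha k) x + ∑ i, P.lam i k k x * starRingEnd ℂ (P.alpha i x))

/-- The second order operator
`Lₘ(f) = ∑ₖ (vₖ(vₖ(f)) + wₖ(wₖ(f)) - 4m Re(αₖ) vₖ(f) - 4m Im(αₖ) wₖ(f)`
`  - 2 ∑ᵢ Re(λⁱₖₖ) vᵢ(f) - 2 ∑ᵢ Im(λⁱₖₖ) wᵢ(f))`. -/
def L (m : ℕ) (f : M → ℝ) : M → ℝ := fun x =>
  ∑ k, (dirDeriv I (P.v k) (dirDeriv I (P.v k) f) x + dirDeriv I (P.w k) (dirDeriv I (P.w k) f) x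
    - 4 * m * (P.alpha k x).re * dirDeriv I (P.v k) f x
    - 4 * m * (P.alpha k x).im * dirDeriv I (P.w k) f x
    - 2 * ∑ i, (P.lam i k k x).re * dirDeriv I (P.v i) f x
    - 2 * ∑ i, (P.lam i k k x).im * dirDeriv I (P.w i) f x)

/-- The function `Re ∑ₖ (𝒳ₖ(αₖ) - m |αₖ|² - ∑ᵢ λⁱₖₖ ᾱᵢ)`. -/
def zerothCoeff (m : ℕ) : M → ℝ := fun x =>
  (∑ k, (P.cX k (P.alpha k) x - m * ((‖P.alpha k x‖ ^ 2 : ℝ) : ℂ)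
    - ∑ i, P.lam i k k x * starRingEnd ℂ (P.alpha i x))).re

/-- `(u, v)` solves the second order system attached to the `m`-canonical sections
`(u + i v) (φ¹ ∧ … ∧ φⁿ)^{⊗ m}`. -/
def IsSolution (m : ℕ) (u v : M → ℝ) : Prop :=
  ∀ x,
    P.L m v x - 4 * m * P.zerothCoeff m x * v x - 4 * m * (P.beta x).im * u x = 0 ∧
    -P.L m u x + 4 * m * P.zerothCoeff m x * u x - 4 * m * (P.beta x).im * v x = 0

theorem phi_v (i j : Fin n) (x : M) : P.phi i x (P.v j x) = if i = j then 1 else 0 := by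
  have h1 := P.isFrame.coeff_apply_of_mem (Set.mem_univ x) (P.v j) (Sum.inl i)
  have h2 := P.isFrame.coeff_apply_of_mem (Set.mem_univ x) (P.v j) (Sum.inr i)
  rw [show P.v j x = P.isFrame.toBasisAt (Set.mem_univ x) (Sum.inl j) by simp,
    Module.Basis.repr_self, Finsupp.single_apply] at h1 h2
  simp only [IsLocalFrameOn.toBasisAt_coe, Sum.elim_inl, reduceCtorEq, if_false] at h1 h2
  simp only [phi, vDual, wDual, LinearMap.add_apply, LinearMap.comp_apply, LinearMap.smul_apply,
    h1, h2]
  by_cases h : i = j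
  · simp [h]
  · simp [h, Ne.symm h]

theorem phi_w (i j : Fin n) (x : M) : P.phi i x (P.w j x) = if i = j then Complex.I else 0 := by
  have h1 := P.isFrame.coeff_apply_of_mem (Set.mem_univ x) (P.w j) (Sum.inl i)
  have h2 := P.isFrame.coeff_apply_of_mem (Set.mem_univ x) (P.w j) (Sum.inr i)
  rw [show P.w j x = P.isFrame.toBasisAt (Set.mem_univ x) (Sum.inr j) by simp,
    Module.Basis.repr_self, Finsupp.single_apply] at h1 h2
  simp only [IsLocalFrameOn.toBasisAt_coe, Sum.elim_inr, reduceCtorEq, if_false] at h1 h2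
  simp only [phi, vDual, wDual, LinearMap.add_apply, LinearMap.comp_apply, LinearMap.smul_apply,
    h1, h2]
  by_cases h : i = j
  · simp [h]
  · simp [h, Ne.symm h]

theorem delbar_v_v (θ : ∀ x : M, TangentSpace I x →ₗ[ℝ] ℂ) (j k : Fin n) (x : M) :
    delbar 𝒥 θ (P.v j) (P.v k) x =
      (extDer I θ (P.v j) (P.v k) x + extDer I θ (P.w j) (P.w k) x) / 2 := by
  have h1 (j) : (fun y => 𝒥.J y (P.v j y)) = P.w j := funext (P.J_v j)
  simp only [delbar, h1]

theorem mdiff_v (j : Fin n) (x : M) : MDiffAt (T% (P.v j)) x :=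
  ((P.isFrame.contMDiffAt isOpen_univ (Set.mem_univ x)) (Sum.inl j)).mdifferentiableAt (by simp)

theorem mdiff_w (j : Fin n) (x : M) : MDiffAt (T% (P.w j)) x :=
  ((P.isFrame.contMDiffAt isOpen_univ (Set.mem_univ x)) (Sum.inr j)).mdifferentiableAt (by simp)

variable [CompleteSpace E]

theorem extDer_neg (θ : ∀ x : M, TangentSpace I x →ₗ[ℝ] ℂ) (X Y : ∀ x : M, TangentSpace I x)
    (x : M) (hX : MDiffAt (T% X) x) : extDer I θ (fun y => -X y) Y x = - extDer I θ X Y x := by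
  have : IsManifold I 1 M := .of_le (n := ∞) (by simp)
  have h1 : VectorField.mlieBracket I (fun y => -X y) Y x = - VectorField.mlieBracket I X Y x := by
    have := VectorField.mlieBracket_const_smul_left (I := I) (W := Y) (c := (-1 : ℝ)) hX
    simpa using! this
  have h2 : dirDeriv I Y (fun y => -(θ y (X y))) x = - dirDeriv I Y (fun y => θ y (X y)) x := by
    have := mvfderiv_neg (I := I) (g := fun y => θ y (X y)) (x := x)
    exact congrArg (fun l => l (Y x)) this
  simp only [extDer, h1, map_neg, h2]
  simp only [dirDeriv, map_neg]
  ring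

theorem delbar_v_w (θ : ∀ x : M, TangentSpace I x →ₗ[ℝ] ℂ) (j k : Fin n) (x : M) :
    delbar 𝒥 θ (P.v j) (P.w k) x =
      (extDer I θ (P.v j) (P.w k) x + extDer I θ (P.v k) (P.w j) x) / 2 := by
  have h1 (j) : (fun y => 𝒥.J y (P.v j y)) = P.w j := funext (P.J_v j)
  have h2 (j) : (fun y => 𝒥.J y (P.w j y)) = fun y => -P.v j y := funext (P.J_w j)
  simp only [delbar, h1, h2]
  rw [extDer_swap _ _ (fun y => -P.v k y), extDer_neg _ _ _ _ (P.mdiff_v k x), neg_neg]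

theorem delbar_w_v (θ : ∀ x : M, TangentSpace I x →ₗ[ℝ] ℂ) (j k : Fin n) (x : M) :
    delbar 𝒥 θ (P.w j) (P.v k) x =
      -(extDer I θ (P.v j) (P.w k) x + extDer I θ (P.v k) (P.w j) x) / 2 := by
  have h1 (j) : (fun y => 𝒥.J y (P.v j y)) = P.w j := funext (P.J_v j)
  have h2 (j) : (fun y => 𝒥.J y (P.w j y)) = fun y => -P.v j y := funext (P.J_w j)
  simp only [delbar, h1, h2]
  rw [extDer_swap _ _ (P.v k), extDer_neg _ _ _ _ (P.mdiff_v j x)]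
  ring

theorem delbar_w_w (θ : ∀ x : M, TangentSpace I x →ₗ[ℝ] ℂ) (j k : Fin n) (x : M) :
    delbar 𝒥 θ (P.w j) (P.w k) x =
      (extDer I θ (P.v j) (P.v k) x + extDer I θ (P.w j) (P.w k) x) / 2 := by
  have h2 (j) : (fun y => 𝒥.J y (P.w j y)) = fun y => -P.v j y := funext (P.J_w j)
  simp only [delbar, h2]
  rw [extDer_neg _ _ _ _ (P.mdiff_v j x), extDer_swap _ _ (fun y => -P.v k y),
    extDer_neg _ _ _ _ (P.mdiff_v k x), extDer_swap _ _ (P.v j)]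
  ring

/-- The defining relation `∂̄φⁱ = ∑ⱼₖ λⁱⱼₖ φʲ ∧ φ̄ᵏ`, evaluated on the vector fields of the
parallelism. -/
theorem delbar_phi_frame (i : Fin n) (s t : Fin n ⊕ Fin n) (x : M) :
    delbar 𝒥 (P.phi i) (Sum.elim P.v P.w s) (Sum.elim P.v P.w t) x =
      ∑ j, ∑ k, P.lam i j k x *
        wedge I (P.phi j x) (conjForm I (P.phi k x))
          (Sum.elim P.v P.w s x) (Sum.elim P.v P.w t x) := by
  have hI : Complex.I ^ 2 = -1 := Complex.I_sq
  have key (a b : Fin n) (z z' : ℂ) :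
      ∑ j, ∑ k, P.lam i j k x *
        ((if j = a then z else 0) * (starRingEnd ℂ) (if k = b then z' else 0) -
          (if j = b then z' else 0) * (starRingEnd ℂ) (if k = a then z else 0)) =
      P.lam i a b x * (z * starRingEnd ℂ z') - P.lam i b a x * (z' * starRingEnd ℂ z) := by
    simp only [mul_sub, Finset.sum_sub_distrib, apply_ite (starRingEnd ℂ), map_zero, mul_ite,
      ite_mul, zero_mul, mul_zero, Finset.sum_ite_eq', Finset.mem_univ, if_true]
  have hc (k : Fin n) (X : TangentSpace I x) :
      conjForm I (P.phi k x) X = starRingEnd ℂ (P.phi k x X) := rfl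
  rcases s with a | a <;> rcases t with b | b <;>
    simp only [Sum.elim_inl, Sum.elim_inr, wedge, hc, phi_v, phi_w] <;>
    rw [key a b] <;>
    simp only [lam, delbar_v_v, delbar_v_w, delbar_w_v, delbar_w_w, map_one, Complex.conj_I,
      extDer_swap _ _ (P.v a) (P.v b), extDer_swap _ _ (P.w a) (P.w b)] <;>
    ring_nf <;> (try simp only [hI]) <;> (try ring)

end AdaptedParallelism

end AlmostComplexPDE

end

/-! Since `β` is real, the system decouples: `u` and `v` each satisfy `L_m f = 4m q_m f`, and the
hypothesis on the `α_k` says exactly that `q_m ≥ 0`. The operator `L_m` is a sum of squares of the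
frame fields plus a continuous drift, without zeroth order term (`L_eq_sumSq`), and it is elliptic
because the frame spans. The strong maximum principle therefore applies: where `f` is near a
positive maximum, `L_m f ≥ 0`, so the set where the maximum is attained is open and closed, and `f`
is constant. If `f` is nowhere positive, the same is applied to `-f`.

The maximum principle is proved intrinsically. Integral curves give the second derivative test along
each field, `not_touching_of_sumSq_nonneg` is Hopf's barrier argument, and
`isOpen_maximum_set_of_sumSq_nonneg` supplies the touching sphere in a chart. Continuity of the
drift reduces to that of the frame coefficients of brackets (`continuousAt_coeff`). -/

noncomputable section

namespace AlmostComplexPDE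

/-! ### Derivatives along vector fields and the second derivative test -/

section VectorFields

open Filter Topology

variable {E H : Type*} [NormedAddCommGroup E] [NormedSpace ℝ E]
  [TopologicalSpace H] {I : ModelWithCorners ℝ E H}
  {M : Type*} [TopologicalSpace M] [ChartedSpace H M]
  {F : Type*} [NormedAddCommGroup F] [NormedSpace ℝ F]
  {X : ∀ x : M, TangentSpace I x} {x : M}

theorem dirDeriv_congr {f g : M → F} (h : f =ᶠ[𝓝 x] g) :
    dirDeriv I X f x = dirDeriv I X g x := by
  have h1 := h.mfderiv_eq (I := I) (I' := 𝓘(ℝ, F))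
  exact congrArg (fun l : E →L[ℝ] F => l (X x)) h1

theorem dirDeriv_add {f g : M → F} (hf : MDifferentiableAt I 𝓘(ℝ, F) f x)
    (hg : MDifferentiableAt I 𝓘(ℝ, F) g x) :
    dirDeriv I X (fun y => f y + g y) x = dirDeriv I X f x + dirDeriv I X g x :=
  congrArg (fun l => l (X x)) (mvfderiv_fun_add hf hg)

theorem dirDeriv_neg {f : M → F} :
    dirDeriv I X (fun y => -f y) x = -dirDeriv I X f x :=
  congrArg (fun l => l (X x)) (mvfderiv_fun_neg (I := I) (g := f) (x := x))

theorem dirDeriv_const (c : F) : dirDeriv I X (fun _ => c) x = 0 :=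
  congrArg (fun l => l (X x)) (mvfderiv_const (I := I) (x := x) c)

theorem dirDeriv_mul {f g : M → ℝ} (hf : MDifferentiableAt I 𝓘(ℝ, ℝ) f x)
    (hg : MDifferentiableAt I 𝓘(ℝ, ℝ) g x) :
    dirDeriv I X (fun y => f y * g y) x = f x * dirDeriv I X g x + g x * dirDeriv I X f x :=
  congrArg (fun l => l (X x)) (mvfderiv_fun_mul hf hg)

theorem dirDeriv_comp {φ : ℝ → ℝ} {f : M → ℝ} (hφ : DifferentiableAt ℝ φ (f x))
    (hf : MDifferentiableAt I 𝓘(ℝ, ℝ) f x) :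
    dirDeriv I X (fun y => φ (f y)) x = deriv φ (f x) * dirDeriv I X f x := by
  have h := hφ.hasDerivAt.hasFDerivAt.hasMFDerivAt.comp x hf.hasMFDerivAt
  have h1 := congrArg (fun l : E →L[ℝ] ℝ => l (X x)) h.mfderiv
  refine h1.trans ?_
  change dirDeriv I X f x * deriv φ (f x) = _
  ring

theorem hasDerivAt_comp_integralCurve {f : M → ℝ} {γ : ℝ → M} {t : ℝ}
    (hγ : HasMFDerivAt 𝓘(ℝ, ℝ) I γ t ((1 : ℝ →L[ℝ] ℝ).smulRight (X (γ t))))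
    (hf : MDifferentiableAt I 𝓘(ℝ, ℝ) f (γ t)) :
    HasDerivAt (fun s => f (γ s)) (dirDeriv I X f (γ t)) t := by
  rw [hasDerivAt_iff_hasFDerivAt]
  refine hasMFDerivAt_iff_hasFDerivAt.1 ?_
  refine (hf.hasMFDerivAt.comp t hγ).congr_mfderiv ?_
  refine ContinuousLinearMap.ext fun (a : ℝ) => ?_
  change mfderiv I 𝓘(ℝ, ℝ) f (γ t) ((a : ℝ) • X (γ t)) = (a : ℝ) • dirDeriv I X f (γ t)
  rw [map_smul]
  rfl

variable [IsManifold I 2 M]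

theorem contMDiffAt_dirDeriv {k n : WithTop ℕ∞} {f : M → F}
    (hX : ContMDiffAt I I.tangent k (fun y => (X y : TotalSpace E (TangentSpace I : M → Type _))) x)
    (hf : ContMDiffAt I 𝓘(ℝ, F) n f x) (hkn : k + 1 ≤ n) :
    ContMDiffAt I 𝓘(ℝ, F) k (dirDeriv I X f) x := by
  have h1 := hf.mfderiv_const hkn
  have h2 := ContMDiffAt.clm_apply_of_inCoordinates (b₁ := id) (b₂ := f) (v := X)
    (ϕ := fun y => mfderiv I 𝓘(ℝ, F) f y) h1 hX (hf.of_le (le_self_add.trans hkn))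
  rw [contMDiffAt_totalSpace] at h2
  refine h2.2.congr_of_eventuallyEq (.of_forall fun y => ?_)
  simp [dirDeriv, mvfderiv]
  rfl

/-- Along an integral curve of `X` through `x`, the first and second derivatives of `f` are `X f`
and `X (X f)`, so this is the one-variable test. No Hessian is needed, and `X` need only be `C^1`.
-/
theorem dirDeriv_eq_zero_and_dirDeriv_dirDeriv_nonpos_of_isLocalMax
    [CompleteSpace E] [BoundarylessManifold I M] {f : M → ℝ}
    (hX : ContMDiffAt I I.tangent 1 (fun y => (X y : TotalSpace E (TangentSpace I : M → Type _))) x)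
    (hf : ContMDiffAt I 𝓘(ℝ, ℝ) 2 f x) (hmax : IsLocalMax f x) :
    dirDeriv I X f x = 0 ∧ dirDeriv I X (dirDeriv I X f) x ≤ 0 := by
  obtain ⟨γ, hγ0, hγ⟩ := exists_isMIntegralCurveAt_of_contMDiffAt_boundaryless (t₀ := 0) hX
  have hXf : ContMDiffAt I 𝓘(ℝ, ℝ) 1 (dirDeriv I X f) x :=
    contMDiffAt_dirDeriv hX hf (by norm_num)
  have hcont : ContinuousAt γ 0 := hγ.continuousAt
  have htend : Tendsto γ (𝓝 0) (𝓝 x) := hγ0 ▸ hcont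
  have hfev : ∀ᶠ y in 𝓝 x, ContMDiffAt I 𝓘(ℝ, ℝ) 2 f y := (contMDiffAt_iff_contMDiffAt_nhds (by simp)).1 hf
  have hd : ∀ᶠ t in 𝓝 (0 : ℝ), HasDerivAt (fun s => f (γ s)) (dirDeriv I X f (γ t)) t := by
    filter_upwards [hγ, htend.eventually hfev] with t ht hft
    exact hasDerivAt_comp_integralCurve ht (hft.mdifferentiableAt (by simp))
  have hmaxγ : IsLocalMax (fun s => f (γ s)) 0 := by
    have := htend.eventually hmax
    simpa [IsLocalMax, IsMaxFilter, hγ0] using this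
  have h0 : dirDeriv I X f x = 0 := by
    have := hmaxγ.hasDerivAt_eq_zero hd.self_of_nhds
    rwa [hγ0] at this
  refine ⟨h0, ?_⟩
  have hderiv : deriv (fun s => f (γ s)) =ᶠ[𝓝 0] fun t => dirDeriv I X f (γ t) :=
    hd.mono fun t ht => ht.deriv
  have hdd : HasDerivAt (fun t => dirDeriv I X f (γ t)) (dirDeriv I X (dirDeriv I X f) x) 0 := by
    have h := hasDerivAt_comp_integralCurve (f := dirDeriv I X f) hγ.self_of_nhds
      (by rw [hγ0]; exact hXf.mdifferentiableAt (by simp))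
    rwa [hγ0] at h
  have hdd' : deriv (deriv fun s => f (γ s)) 0 = dirDeriv I X (dirDeriv I X f) x := by
    rw [hderiv.deriv_eq, hdd.deriv]
  -- A positive second derivative would make `0` a local minimum as well, so `f ∘ γ` would be
  -- locally constant with zero second derivative.
  by_contra! hpos
  have hmin : IsLocalMin (fun s => f (γ s)) 0 := by
    apply isLocalMin_of_deriv_deriv_pos
    · rw [hdd']; exact hpos
    · rw [hd.self_of_nhds.deriv, hγ0, h0]
    · exact hd.self_of_nhds.continuousAt
  have hconst : (fun s => f (γ s)) =ᶠ[𝓝 0] fun _ => f (γ 0) := by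
    filter_upwards [hmin, hmaxγ] with t h1 h2
    exact le_antisymm h2 h1
  have h1 : deriv (deriv fun s => f (γ s)) 0 = 0 := by
    rw [hconst.deriv.deriv_eq]
    simp
  linarith

end VectorFields

/-! ### Operators of the form sum of squares plus drift, and Hopf's lemma -/

section SumOfSquares

open Filter Topology

variable {E H : Type*} [NormedAddCommGroup E] [NormedSpace ℝ E]
  [TopologicalSpace H] {I : ModelWithCorners ℝ E H}
  {M : Type*} [TopologicalSpace M] [ChartedSpace H M]
  {ι : Type*} [Fintype ι]

variable (I) in
/-- The second order operator `∑ᵢ (Xᵢ² + bᵢ Xᵢ)`. -/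
def sumSq (X : ι → ∀ x : M, TangentSpace I x) (b : ι → M → ℝ) (f : M → ℝ) : M → ℝ := fun x =>
  ∑ i, (dirDeriv I (X i) (dirDeriv I (X i) f) x + b i x * dirDeriv I (X i) f x)

variable {X : ι → ∀ x : M, TangentSpace I x} {b : ι → M → ℝ} {x : M} [IsManifold I 2 M]

theorem sumSq_add {f g : M → ℝ}
    (hX : ∀ i, ContMDiffAt I I.tangent 1
      (fun y => (X i y : TotalSpace E (TangentSpace I : M → Type _))) x)
    (hf : ContMDiffAt I 𝓘(ℝ, ℝ) 2 f x) (hg : ContMDiffAt I 𝓘(ℝ, ℝ) 2 g x) :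
    sumSq I X b (fun y => f y + g y) x = sumSq I X b f x + sumSq I X b g x := by
  simp only [sumSq, ← Finset.sum_add_distrib]
  refine Finset.sum_congr rfl fun i _ => ?_
  have h1 : dirDeriv I (X i) (fun y => f y + g y) =ᶠ[𝓝 x]
      fun y => dirDeriv I (X i) f y + dirDeriv I (X i) g y := by
    filter_upwards [(contMDiffAt_iff_contMDiffAt_nhds (by simp)).1 hf, (contMDiffAt_iff_contMDiffAt_nhds (by simp)).1 hg] with y hfy hgy
    exact dirDeriv_add (hfy.mdifferentiableAt (by simp)) (hgy.mdifferentiableAt (by simp))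
  rw [dirDeriv_congr h1, h1.self_of_nhds, dirDeriv_add]
  · ring
  · exact (contMDiffAt_dirDeriv (hX i) hf (k := 1) (by norm_num)).mdifferentiableAt (by simp)
  · exact (contMDiffAt_dirDeriv (hX i) hg (k := 1) (by norm_num)).mdifferentiableAt (by simp)

/-- For the barrier `φ(t) = ε exp(-a t)` the square term carries `a ^ 2` and the other only `a`, so
large `a` makes the result positive wherever some `X i f` is nonzero. -/
theorem sumSq_comp {φ : ℝ → ℝ} {f : M → ℝ} (hφ : ContDiff ℝ 2 φ)
    (hX : ∀ i, ContMDiffAt I I.tangent 1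
      (fun y => (X i y : TotalSpace E (TangentSpace I : M → Type _))) x)
    (hf : ContMDiffAt I 𝓘(ℝ, ℝ) 2 f x) :
    sumSq I X b (fun y => φ (f y)) x =
      deriv (deriv φ) (f x) * ∑ i, dirDeriv I (X i) f x ^ 2 + deriv φ (f x) * sumSq I X b f x := by
  simp only [sumSq, Finset.mul_sum, ← Finset.sum_add_distrib]
  refine Finset.sum_congr rfl fun i _ => ?_
  have hφ1 : ContDiff ℝ 1 (deriv φ) := ((contDiff_succ_iff_deriv (n := 1)).1 hφ).2.2
  have hφd : Differentiable ℝ φ := hφ.differentiable (by simp)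
  have hφ1d : Differentiable ℝ (deriv φ) := hφ1.differentiable (by simp)
  have hfd := hf.mdifferentiableAt (n := 2) (by simp)
  have h1 : dirDeriv I (X i) (fun y => φ (f y)) =ᶠ[𝓝 x]
      fun y => deriv φ (f y) * dirDeriv I (X i) f y := by
    filter_upwards [(contMDiffAt_iff_contMDiffAt_nhds (by simp)).1 hf] with y hfy
    exact dirDeriv_comp hφd.differentiableAt (hfy.mdifferentiableAt (by simp))
  rw [dirDeriv_congr h1, h1.self_of_nhds, dirDeriv_mul, dirDeriv_comp hφ1d.differentiableAt hfd]
  · ring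
  · exact (hφ1d.differentiableAt.mdifferentiableAt).comp x hfd
  · exact (contMDiffAt_dirDeriv (hX i) hf (k := 1) (by norm_num)).mdifferentiableAt (by simp)

theorem sumSq_nonpos_of_isLocalMax [CompleteSpace E] [BoundarylessManifold I M] {f : M → ℝ}
    (hX : ∀ i, ContMDiffAt I I.tangent 1
      (fun y => (X i y : TotalSpace E (TangentSpace I : M → Type _))) x)
    (hf : ContMDiffAt I 𝓘(ℝ, ℝ) 2 f x) (hmax : IsLocalMax f x) : sumSq I X b f x ≤ 0 := by
  refine Finset.sum_nonpos fun i _ => ?_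
  obtain ⟨h1, h2⟩ :=
    dirDeriv_eq_zero_and_dirDeriv_dirDeriv_nonpos_of_isLocalMax (hX i) hf hmax
  rw [h1]
  linarith

theorem continuousAt_sumSq {f : M → ℝ}
    (hX : ∀ i, ContMDiffAt I I.tangent 1
      (fun y => (X i y : TotalSpace E (TangentSpace I : M → Type _))) x)
    (hb : ∀ i, ContinuousAt (b i) x) (hf : ContMDiffAt I 𝓘(ℝ, ℝ) 2 f x) :
    ContinuousAt (sumSq I X b f) x := by
  refine tendsto_finsetSum _ fun i _ => ?_
  have h1 := contMDiffAt_dirDeriv (hX i) hf (k := 1) (by norm_num)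
  have h2 := contMDiffAt_dirDeriv ((hX i).of_le zero_le_one) h1 (k := 0) (by norm_num)
  exact h2.continuousAt.add ((hb i).mul h1.continuousAt)

/-- Hopf's lemma: a subsolution cannot attain its maximum at a point of a hypersurface `ρ = const`
on one side of which it stays below the maximum. -/
theorem not_touching_of_sumSq_nonneg [CompleteSpace E] [BoundarylessManifold I M] [T2Space M]
    [LocallyCompactSpace M] {u ρ : M → ℝ}
    (hX : ∀ i x, ContMDiffAt I I.tangent 1
      (fun y => (X i y : TotalSpace E (TangentSpace I : M → Type _))) x)
    (hb : ∀ i, ContinuousAt (b i) x)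
    (hu : ContMDiff I 𝓘(ℝ, ℝ) 2 u) (hmax : ∀ y, u y ≤ u x)
    (hL : ∀ᶠ y in 𝓝 x, 0 ≤ sumSq I X b u y)
    (hρ : ContMDiffAt I 𝓘(ℝ, ℝ) 2 ρ x) (hρ0 : ∀ y, 0 ≤ ρ y)
    (htouch : ∀ᶠ y in 𝓝 x, ρ y ≤ ρ x → u y = u x → y = x) :
    ∀ i, dirDeriv I (X i) ρ x = 0 := by
  intro i₀
  by_contra hi₀
  set Q : M → ℝ := fun y => ∑ i, dirDeriv I (X i) ρ y ^ 2 with hQ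
  have hQpos : 0 < Q x :=
    Finset.sum_pos' (fun i _ => sq_nonneg _) ⟨i₀, Finset.mem_univ _, by positivity⟩
  have hQc : ContinuousAt Q x := tendsto_finsetSum _ fun i _ =>
    ((contMDiffAt_dirDeriv (hX i x) hρ (k := 1) (by norm_num)).continuousAt).pow 2
  have hLc : ContinuousAt (sumSq I X b ρ) x := continuousAt_sumSq (fun i => hX i x) hb hρ
  -- Large enough that `a * Q - sumSq ρ` is positive at `x`, hence nearby; up to the factor `a *
  -- φ(ρ)` this is the operator applied to the barrier `φ ∘ ρ`.
  set a : ℝ := (|sumSq I X b ρ x| + 1) / Q x with ha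
  have hapos : 0 < a := by positivity
  have hax : sumSq I X b ρ x < a * Q x := by
    rw [ha, div_mul_cancel₀ _ hQpos.ne']
    linarith [le_abs_self (sumSq I X b ρ x)]
  have hev : ∀ᶠ y in 𝓝 x, sumSq I X b ρ y < a * Q y :=
    hLc.eventually_lt (continuousAt_const.mul hQc) hax
  obtain ⟨K, hKx, hKS, hK⟩ := local_compact_nhds
    (hev.and (hL.and (((contMDiffAt_iff_contMDiffAt_nhds (by simp)).1 hρ).and htouch)))
  have hρK : ContinuousOn ρ K := fun y hy => (hKS hy).2.2.1.continuousAt.continuousWithinAt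
  set C : Set M := frontier K ∩ {y | ρ y ≤ ρ x} with hC
  have hfK : frontier K ⊆ K := hK.isClosed.frontier_subset
  have hCc : IsCompact C := by
    have h1 : IsClosed C :=
      (hρK.mono hfK).preimage_isClosed_of_isClosed isClosed_frontier (isClosed_Iic (a := ρ x))
    exact hK.of_isClosed_subset h1 (Set.inter_subset_left.trans hfK)
  have hxint : x ∈ interior K := mem_interior_iff_mem_nhds.2 hKx
  have hCu : ∀ y ∈ C, u y < u x := fun y hy => by
    refine lt_of_le_of_ne (hmax y) fun h => ?_
    have : y = x := (hKS (hfK hy.1)).2.2.2 hy.2 h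
    exact hy.1.2 (this ▸ hxint)
  -- On the compact part `C` of the frontier, `u` stays below its maximum by a uniform gap; this gap
  -- is the amplitude of the barrier.
  obtain ⟨ε, hε, hεC⟩ : ∃ ε : ℝ, 0 < ε ∧ ∀ y ∈ C, u y + ε < u x := by
    rcases C.eq_empty_or_nonempty with h | h
    · exact ⟨1, one_pos, by simp [h]⟩
    · obtain ⟨c, hc, hcmax⟩ := hCc.exists_isMaxOn h hu.continuous.continuousOn
      refine ⟨(u x - u c) / 2, by linarith [hCu c hc], fun y hy => ?_⟩
      have h1 : u y ≤ u c := hcmax hy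
      linarith [hCu c hc]
  set φ : ℝ → ℝ := fun t => ε * Real.exp (-a * t) with hφ
  have hφ1 : deriv φ = fun t => -a * φ t := by
    funext t
    have : HasDerivAt φ (ε * (Real.exp (-a * t) * (-a * 1))) t :=
      (((hasDerivAt_id t).const_mul (-a)).exp).const_mul ε
    rw [this.deriv]
    ring
  have hφ2 : deriv (deriv φ) = fun t => a ^ 2 * φ t := by
    funext t
    rw [hφ1, deriv_const_mul_field, hφ1]
    ring
  have hφs : ContDiff ℝ 2 φ := by fun_prop
  have hφpos (t : ℝ) : 0 < φ t := by positivity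
  set g : M → ℝ := fun y => u y + φ (ρ y) with hg
  have hgK : ContinuousOn g K :=
    hu.continuous.continuousOn.add (hφs.continuous.comp_continuousOn hρK)
  obtain ⟨z, hzK, hz⟩ := hK.exists_isMaxOn ⟨x, mem_of_mem_nhds hKx⟩ hgK
  have hzx : g x ≤ g z := hz (mem_of_mem_nhds hKx)
  -- On the frontier `g < g x`: where `ρ ≤ ρ x`, the gap `ε` beats `φ(ρ) ≤ ε` (which uses `ρ ≥ 0`);
  -- where `ρ > ρ x`, the barrier is smaller than at `x` and `u ≤ u x`.
  have hzint : z ∈ interior K := by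
    by_contra hzn
    have hzf : z ∈ frontier K := ⟨subset_closure hzK, hzn⟩
    by_cases hρz : ρ z ≤ ρ x
    · have h1 := hεC z ⟨hzf, hρz⟩
      have h2 : φ (ρ z) ≤ ε := by
        have : Real.exp (-a * ρ z) ≤ 1 := Real.exp_le_one_iff.2 (by nlinarith [hρ0 z])
        simp only [hφ]
        nlinarith
      have h3 := hφpos (ρ x)
      simp only [hg] at hzx
      linarith
    · have h1 : φ (ρ z) < φ (ρ x) := by
        have : Real.exp (-a * ρ z) < Real.exp (-a * ρ x) :=
          Real.exp_lt_exp.2 (by nlinarith [not_le.1 hρz])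
        simp only [hφ]
        nlinarith
      have h2 := hmax z
      simp only [hg] at hzx
      linarith
  have hzmax : IsLocalMax g z := hz.isLocalMax (mem_interior_iff_mem_nhds.1 hzint)
  obtain ⟨hz1, hz2, hz3, -⟩ := hKS hzK
  have hφρ : ContMDiffAt I 𝓘(ℝ, ℝ) 2 (fun y => φ (ρ y)) z :=
    hφs.contMDiff.contMDiffAt.comp z hz3
  have h1 : sumSq I X b g z ≤ 0 :=
    sumSq_nonpos_of_isLocalMax (fun i => hX i z) ((hu z).add hφρ) hzmax
  rw [hg, sumSq_add (fun i => hX i z) (hu z) hφρ, sumSq_comp hφs (fun i => hX i z) hz3, hφ2,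
    hφ1] at h1
  -- The operator is positive on the barrier and nonnegative on `u`, contradicting the interior
  -- maximum of `g` at `z`.
  have h2 : 0 < a * φ (ρ z) * (a * Q z - sumSq I X b ρ z) :=
    mul_pos (mul_pos hapos (hφpos _)) (by linarith)
  simp only [hQ] at h2
  nlinarith

end SumOfSquares

/-! ### The strong maximum principle -/

section StrongMaximumPrinciple

open Filter Topology

variable {E H : Type*} [NormedAddCommGroup E] [InnerProductSpace ℝ E] [FiniteDimensional ℝ E]
  [TopologicalSpace H] {I : ModelWithCorners ℝ E H} [I.Boundaryless]
  {M : Type*} [TopologicalSpace M] [ChartedSpace H M] [IsManifold I 2 M] [T2Space M]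
  {ι : Type*} [Fintype ι] {X : ι → ∀ x : M, TangentSpace I x} {b : ι → M → ℝ}

/-- If the set were not open, a chart sphere centred at a nearby point outside it would touch it at
a closest point. Hopf's lemma makes the derivative of the defining function vanish there along a
spanning family, whereas its gradient is nonzero. -/
theorem isOpen_maximum_set_of_sumSq_nonneg {u : M → ℝ} {N : ℝ}
    (hX : ∀ i x, ContMDiffAt I I.tangent 1
      (fun y => (X i y : TotalSpace E (TangentSpace I : M → Type _))) x)
    (hspan : ∀ x, ⊤ ≤ Submodule.span ℝ (Set.range (X · x)))
    (hb : ∀ i, Continuous (b i)) (hu : ContMDiff I 𝓘(ℝ, ℝ) 2 u) (hmax : ∀ y, u y ≤ N)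
    (hL : ∀ x, u x = N → ∀ᶠ y in 𝓝 x, 0 ≤ sumSq I X b u y) :
    IsOpen {x | u x = N} := by
  have : LocallyCompactSpace M := Manifold.locallyCompact_of_finiteDimensional I
  have : IsManifold I 1 M := .of_le (n := 2) (by norm_num)
  rw [isOpen_iff_mem_nhds]
  by_contra! hcon
  obtain ⟨p, hp, hpn⟩ := hcon
  set e := extChartAt I p with he
  have hpT : e.target ∈ 𝓝 (e p) := extChartAt_target_mem_nhds p
  obtain ⟨δ, hδ, hδT⟩ := Metric.nhds_basis_closedBall.mem_iff.1 hpT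
  obtain ⟨r, hr, rfl⟩ : ∃ r : ℝ, 0 < r ∧ 2 * r = δ := ⟨δ / 2, by positivity, by ring⟩
  obtain ⟨q, hqs, hqr, hqN⟩ : ∃ q ∈ e.source, dist (e q) (e p) < r ∧ u q ≠ N := by
    by_contra! h
    refine hpn ?_
    filter_upwards [extChartAt_source_mem_nhds (I := I) p,
      (continuousAt_extChartAt (I := I) p).eventually (Metric.ball_mem_nhds (e p) hr)] with x h1 h2
    exact h x h1 h2
  set K : Set E := Metric.closedBall (e p) (2 * r) ∩ {z | u (e.symm z) = N} with hK
  have hKc : IsCompact K := by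
    refine (isCompact_closedBall (e p) (2 * r)).of_isClosed_subset ?_ Set.inter_subset_left
    have h1 : ContinuousOn (fun z => u (e.symm z)) (Metric.closedBall (e p) (2 * r)) :=
      hu.continuous.comp_continuousOn ((continuousOn_extChartAt_symm p).mono hδT)
    exact h1.preimage_isClosed_of_isClosed Metric.isClosed_closedBall (isClosed_singleton (x := N))
  have hpK : e p ∈ K :=
    ⟨Metric.mem_closedBall_self (by positivity), by simpa [he] using hp⟩
  -- As `e p` lies in `K` at distance less than `r` from `e q`, so does the closest point `z`. It is
  -- thus in the open ball of radius `2 * r`, and truncating to the closed ball does no harm.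
  obtain ⟨z, hzK, hz⟩ := hKc.exists_isMinOn ⟨_, hpK⟩
    (continuous_id.dist (continuous_const (y := e q))).continuousOn
  have hzq : dist z (e q) < r := lt_of_le_of_lt (hz hpK) ((dist_comm (e p) (e q)).trans_lt hqr)
  have hzp : dist z (e p) < 2 * r := by linarith [dist_triangle z (e q) (e p)]
  have hzT : z ∈ e.target := hδT hzK.1
  set x := e.symm z with hx
  have hxs : x ∈ e.source := e.map_target hzT
  have hex : e x = z := e.right_inv hzT
  have hux : u x = N := hzK.2
  have hne : z - e q ≠ 0 := fun h => hqN <| by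
    have h1 : u (e.symm z) = N := hzK.2
    rwa [sub_eq_zero.1 h, e.left_inv hqs] at h1
  -- The second term makes the contact strict, as other points of `K` may be equally close to `e q`;
  -- its gradient vanishes at `z`, leaving `2 (z - e q)`.
  set ψ : E → ℝ := fun y => ‖y - e q‖ ^ 2 + ‖y - z‖ ^ 2 with hψ
  have hψs : ContDiff ℝ 2 ψ :=
    ((contDiff_id.sub contDiff_const).norm_sq ℝ).add ((contDiff_id.sub contDiff_const).norm_sq ℝ)
  have hes : ContMDiffAt I 𝓘(ℝ, E) 2 e x :=
    contMDiffAt_extChartAt' (by rwa [← extChartAt_source I])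
  have hρ : ContMDiffAt I 𝓘(ℝ, ℝ) 2 (fun y => ψ (e y)) x := hψs.contMDiff.contMDiffAt.comp x hes
  have htouch : ∀ᶠ y in 𝓝 x, ψ (e y) ≤ ψ (e x) → u y = u x → y = x := by
    have h1 : ∀ᶠ y in 𝓝 x, e y ∈ Metric.ball (e p) (2 * r) :=
      hes.continuousAt.eventually (Metric.isOpen_ball.mem_nhds (by rwa [hex]))
    filter_upwards [h1, (isOpen_extChartAt_source (I := I) p).mem_nhds hxs] with y hy1 hys h2 h3
    have hyK : e y ∈ K := ⟨Metric.ball_subset_closedBall hy1, by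
      change u (e.symm (e y)) = N
      rw [e.left_inv hys, h3, hux]⟩
    have h4 : dist z (e q) ≤ dist (e y) (e q) := hz hyK
    rw [dist_eq_norm, dist_eq_norm] at h4
    have h5 : ‖z - e q‖ ^ 2 ≤ ‖e y - e q‖ ^ 2 := by gcongr
    simp only [hψ, hex, sub_self, norm_zero] at h2
    have h6 : ‖e y - z‖ ^ 2 = 0 := le_antisymm (by linarith) (by positivity)
    have h7 : e y = z := by simpa [sub_eq_zero] using h6
    exact e.injOn hys hxs (h7.trans hex.symm)
  have hzero := not_touching_of_sumSq_nonneg (X := X) (b := b) hX (fun i => (hb i).continuousAt)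
    hu (fun y => hux ▸ hmax y) (hL x hux) hρ (fun y => by positivity) htouch
  have hd : mvfderiv I (fun y => ψ (e y)) x = 0 := by
    refine ContinuousLinearMap.coe_injective (LinearMap.ext_on_range (v := (X · x)) ?_ hzero)
    exact top_le_iff.1 (hspan x)
  obtain ⟨T, hT⟩ := isInvertible_mfderiv_extChartAt (I := I) hxs
  have hψd : HasFDerivAt ψ (2 • innerSL ℝ (z - e q)) (e x) := by
    rw [hex]
    have h1 : HasFDerivAt (fun y : E => y - e q) (ContinuousLinearMap.id ℝ E) z :=
      (hasFDerivAt_id z).sub_const _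
    have h2 : HasFDerivAt (fun y : E => y - z) (ContinuousLinearMap.id ℝ E) z :=
      (hasFDerivAt_id z).sub_const _
    refine (h1.norm_sq.add h2.norm_sq).congr_fderiv ?_
    ext w
    simp
  have hcomp := (hψd.hasMFDerivAt.comp x (hes.mdifferentiableAt (by simp)).hasMFDerivAt).mfderiv
  have h1 : mvfderiv I (fun y => ψ (e y)) x (T.symm (z - e q)) = 2 * ‖z - e q‖ ^ 2 := by
    refine (congrArg (fun l : E →L[ℝ] ℝ => l (T.symm (z - e q))) hcomp).trans ?_
    have h2 : mfderiv I 𝓘(ℝ, E) e x (T.symm (z - e q)) = z - e q := by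
      rw [he, ← hT]
      exact T.apply_symm_apply _
    change (2 • innerSL ℝ (z - e q)) (mfderiv I 𝓘(ℝ, E) e x (T.symm (z - e q))) = _
    rw [h2, ← real_inner_self_eq_norm_sq, two_mul, ← two_nsmul]
    rfl
  rw [hd] at h1
  have h3 : 0 < 2 * ‖z - e q‖ ^ 2 := by positivity
  rw [← h1] at h3
  exact lt_irrefl _ h3

theorem eq_const_of_sumSq_eq_mul [CompactSpace M] [ConnectedSpace M] {u c : M → ℝ}
    (hX : ∀ i x, ContMDiffAt I I.tangent 1
      (fun y => (X i y : TotalSpace E (TangentSpace I : M → Type _))) x)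
    (hspan : ∀ x, ⊤ ≤ Submodule.span ℝ (Set.range (X · x)))
    (hb : ∀ i, Continuous (b i)) (hu : ContMDiff I 𝓘(ℝ, ℝ) 2 u) (hc : ∀ x, 0 ≤ c x)
    (hL : ∀ x, sumSq I X b u x = c x * u x) : ∃ a, ∀ x, u x = a := by
  have key (w : M → ℝ) (hw : ContMDiff I 𝓘(ℝ, ℝ) 2 w) (hLw : ∀ x, sumSq I X b w x = c x * w x)
      (x₀ : M) (hx₀ : 0 < w x₀) : ∃ a, ∀ x, w x = a := by
    obtain ⟨p, -, hp⟩ := isCompact_univ.exists_isMaxOn ⟨x₀, Set.mem_univ _⟩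
      hw.continuous.continuousOn
    have hmax (y : M) : w y ≤ w p := hp (Set.mem_univ y)
    have hopen : IsOpen {x | w x = w p} := by
      refine isOpen_maximum_set_of_sumSq_nonneg (X := X) (b := b) hX hspan hb hw hmax fun x hx => ?_
      -- Positivity of the maximum is what turns `c ≥ 0` into `c * w ≥ 0` near `x`.
      have hpos : 0 < w x := hx ▸ hx₀.trans_le (hmax x₀)
      filter_upwards [hw.continuous.continuousAt.eventually_const_lt hpos] with y hy
      rw [hLw]
      exact mul_nonneg (hc y) hy.le
    have hclopen : IsClopen {x | w x = w p} :=
      ⟨isClosed_eq hw.continuous continuous_const, hopen⟩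
    have huniv := hclopen.eq_univ ⟨p, rfl⟩
    exact ⟨w p, fun x => (Set.ext_iff.1 huniv x).2 (Set.mem_univ x)⟩
  by_cases h : ∃ x, 0 < u x
  · obtain ⟨x, hx⟩ := h
    exact key u hu hL x hx
  by_cases h' : ∃ x, 0 < -u x
  · obtain ⟨x, hx⟩ := h'
    obtain ⟨a, ha⟩ := key (fun y => -u y) hu.neg (fun x => by
      have h1 (i : ι) : dirDeriv I (X i) (fun y => -u y) = fun y => -dirDeriv I (X i) u y :=
        funext fun y => dirDeriv_neg
      have h2 : sumSq I X b (fun y => -u y) x = -sumSq I X b u x := by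
        simp only [sumSq, h1, dirDeriv_neg, ← Finset.sum_neg_distrib]
        exact Finset.sum_congr rfl fun i _ => by ring
      rw [h2, hL]
      ring) x hx
    exact ⟨-a, fun y => by rw [← ha y, neg_neg]⟩
  · push Not at h h'
    exact ⟨0, fun x => le_antisymm (h x) (by linarith [h' x])⟩

end StrongMaximumPrinciple

/-! ### Continuity of coefficients in a frame -/

section FrameCoefficients

open Filter Topology

variable {E H : Type*} [NormedAddCommGroup E] [NormedSpace ℝ E] [FiniteDimensional ℝ E]
  [TopologicalSpace H] {I : ModelWithCorners ℝ E H}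
  {M : Type*} [TopologicalSpace M] [ChartedSpace H M] [IsManifold I 1 M]
  {ι : Type*} [Fintype ι] {s : ι → ∀ x : M, TangentSpace I x} {k : WithTop ℕ∞} {x : M}

omit [FiniteDimensional ℝ E] in
theorem continuousAt_trivializationAt {Y : ∀ x : M, TangentSpace I x}
    (hY : ContMDiffAt I I.tangent 0
      (fun y => (Y y : TotalSpace E (TangentSpace I : M → Type _))) x) :
    ContinuousAt
      (fun y => (trivializationAt E (TangentSpace I) x).linearMapAt ℝ y (Y y)) x := by
  rw [contMDiffAt_totalSpace] at hY
  refine hY.2.continuousAt.congr ?_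
  filter_upwards [(trivializationAt E (TangentSpace I) x).open_baseSet.mem_nhds
    (FiberBundle.mem_baseSet_trivializationAt' x)] with y hy
  rw [Trivialization.coe_linearMapAt_of_mem _ hy]

/-- Cramer's rule: in a trivialization the coefficients solve a linear system whose matrix and
right-hand side are continuous at `x`. -/
theorem continuousAt_coeff (hs : IsLocalFrameOn I E k s Set.univ)
    {Y : ∀ x : M, TangentSpace I x}
    (hY : ContMDiffAt I I.tangent 0
      (fun y => (Y y : TotalSpace E (TangentSpace I : M → Type _))) x) (i : ι) :
    ContinuousAt (fun y => hs.coeff i y (Y y)) x := by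
  classical
  set e := trivializationAt E (TangentSpace I : M → Type _) x with he
  have hxe : x ∈ e.baseSet := FiberBundle.mem_baseSet_trivializationAt' x
  -- Taking the frame at `x` itself as basis of the model space makes the matrix `A` equal to `1` at
  -- `x`, hence invertible nearby.
  set B : Module.Basis ι ℝ E :=
    (hs.toBasisAt (Set.mem_univ x)).map (e.linearEquivAt ℝ x hxe) with hB
  have hrepr {f : M → E} (hf : ContinuousAt f x) (a : ι) : ContinuousAt (fun y => B.repr (f y) a) x :=
    (LinearMap.continuous_of_finiteDimensional (B.coord a)).continuousAt.comp hf
  set A : M → Matrix ι ι ℝ := fun y =>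
    Matrix.of fun a j => B.repr (e.linearMapAt ℝ y (s j y)) a with hA
  set c : M → ι → ℝ := fun y j => hs.coeff j y (Y y) with hc
  set d : M → ι → ℝ := fun y a => B.repr (e.linearMapAt ℝ y (Y y)) a with hd
  have hAc : ContinuousAt A x := continuousAt_pi.2 fun a => continuousAt_pi.2 fun j =>
    hrepr (continuousAt_trivializationAt
      ((hs.contMDiffAt isOpen_univ (Set.mem_univ x) j).of_le zero_le)) a
  have hdc : ContinuousAt d x := continuousAt_pi.2 fun a => hrepr (continuousAt_trivializationAt hY) a
  have hAx : A x = 1 := by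
    ext a j
    have h1 : e.linearMapAt ℝ x (s j x) = B j := by
      simp [hB, Trivialization.coe_linearMapAt_of_mem _ hxe]
    simp [hA, h1, Matrix.one_apply, Finsupp.single_apply, eq_comm]
  have hdet : ∀ᶠ y in 𝓝 x, (A y).det ≠ 0 :=
    (continuous_id.matrix_det.continuousAt.comp hAc).eventually_ne (by simp [hAx])
  have hmul (y : M) : (A y).mulVec (c y) = d y := by
    funext a
    have h1 : e.linearMapAt ℝ y (Y y) = ∑ j, c y j • e.linearMapAt ℝ y (s j y) := by
      simpa only [map_sum, map_smul] using
        congrArg (e.linearMapAt ℝ y) (hs.coeff_sum_eq Y (Set.mem_univ y))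
    simp only [hd, h1, map_sum, map_smul, Finsupp.coe_finsetSum, Finset.sum_apply,
      Finsupp.smul_apply, smul_eq_mul, Matrix.mulVec, dotProduct, hA, Matrix.of_apply, mul_comm]
  have hsol : c =ᶠ[𝓝 x] fun y => ((A y).det)⁻¹ • ((A y).adjugate.mulVec (d y)) := by
    filter_upwards [hdet] with y hy
    rw [← hmul, Matrix.mulVec_mulVec, Matrix.adjugate_mul, Matrix.smul_mulVec, Matrix.one_mulVec,
      smul_smul, inv_mul_cancel₀ hy, one_smul]
  clear_value A d
  have hcc : ContinuousAt c x := by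
    refine ContinuousAt.congr ?_ hsol.symm
    refine ((continuous_id.matrix_det.continuousAt.comp hAc).inv₀ (by simp [hAx])).smul ?_
    have h1 : Continuous fun q : Matrix ι ι ℝ × (ι → ℝ) => q.1.adjugate.mulVec q.2 :=
      continuous_fst.matrix_adjugate.matrix_mulVec continuous_snd
    exact ContinuousAt.comp (f := fun y => (A y, d y)) h1.continuousAt (hAc.prodMk hdc)
  exact continuousAt_pi.1 hcc i

end FrameCoefficients

/-! ### The operator `L_m` as a sum of squares with continuous drift -/

namespace AdaptedParallelism

open Filter Topology

variable {E H : Type*} [NormedAddCommGroup E] [NormedSpace ℝ E] [FiniteDimensional ℝ E]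
  [TopologicalSpace H] {I : ModelWithCorners ℝ E H}
  {M : Type*} [TopologicalSpace M] [ChartedSpace H M] [IsManifold I ∞ M]
  {𝒥 : AlmostComplexStructure I M} {n : ℕ} (P : AdaptedParallelism 𝒥 n)

/-- Each `φⁱ` is constant on every frame field, so only `-φⁱ([X, Y])` survives, a combination of
frame coefficients of a bracket. -/
theorem continuous_extDer_phi_frame (i : Fin n) (s t : Fin n ⊕ Fin n) :
    Continuous (extDer I (P.phi i) (Sum.elim P.v P.w s) (Sum.elim P.v P.w t)) := by
  have h1 : IsManifold I 1 M := .of_le (n := ∞) (by simp)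
  have h2 : IsManifold I (((1 : ℕ∞) : WithTop ℕ∞) + 1) M :=
    .of_le (n := ∞) (by norm_cast)
  have h3 : IsManifold I (minSmoothness ℝ 2) M := by
    rw [minSmoothness_of_isRCLikeNormedField]
    exact h2
  have hconst (r : Fin n ⊕ Fin n) :
      ∃ a : ℂ, (fun y => P.phi i y (Sum.elim P.v P.w r y)) = fun _ => a := by
    rcases r with j | j
    · exact ⟨_, funext fun y => P.phi_v i j y⟩
    · exact ⟨_, funext fun y => P.phi_w i j y⟩
  obtain ⟨a, ha⟩ := hconst s
  obtain ⟨a', ha'⟩ := hconst t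
  refine continuous_iff_continuousAt.2 fun x => ?_
  have hsm (r : Fin n ⊕ Fin n) := (P.isFrame.contMDiffAt isOpen_univ (Set.mem_univ x) r).of_le
    (n := ∞) (m := ((1 : ℕ∞) : WithTop ℕ∞)) (by exact_mod_cast le_top)
  have hbr := (hsm s).mlieBracket_vectorField (m := 0) (hsm t) (by simp)
  have heq : extDer I (P.phi i) (Sum.elim P.v P.w s) (Sum.elim P.v P.w t) = fun y =>
      -((P.isFrame.coeff (Sum.inl i) y (VectorField.mlieBracket I (Sum.elim P.v P.w s)
          (Sum.elim P.v P.w t) y) : ℝ) +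
        Complex.I * (P.isFrame.coeff (Sum.inr i) y (VectorField.mlieBracket I
          (Sum.elim P.v P.w s) (Sum.elim P.v P.w t) y) : ℝ) : ℂ) := by
    funext y
    simp only [extDer, ha, ha', dirDeriv_const, sub_zero, zero_sub]
    rfl
  rw [heq]
  have hc (r : Fin n ⊕ Fin n) := Complex.continuous_ofReal.continuousAt.comp
    (continuousAt_coeff P.isFrame hbr r)
  exact ((hc (Sum.inl i)).add (continuousAt_const.mul (hc (Sum.inr i)))).neg

theorem continuous_lam (i j k : Fin n) : Continuous (P.lam i j k) := by
  have hvv := P.continuous_extDer_phi_frame i (Sum.inl j) (Sum.inl k)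
  have hvw := P.continuous_extDer_phi_frame i (Sum.inl j) (Sum.inr k)
  have hvw' := P.continuous_extDer_phi_frame i (Sum.inl k) (Sum.inr j)
  have hww := P.continuous_extDer_phi_frame i (Sum.inr j) (Sum.inr k)
  simp only [Sum.elim_inl, Sum.elim_inr] at hvv hvw hvw' hww
  have : CompleteSpace E := FiniteDimensional.complete ℝ E
  unfold lam
  simp only [delbar_v_v, delbar_v_w, delbar_w_v, delbar_w_w]
  fun_prop

theorem continuous_alpha (k : Fin n) : Continuous (P.alpha k) :=
  continuous_finsetSum _ fun i _ => P.continuous_lam i i k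

/-- The coefficients of the first order part of `Lₘ`. -/
def driftCoeff (m : ℕ) : Fin n ⊕ Fin n → M → ℝ :=
  Sum.elim (fun i x => -4 * m * (P.alpha i x).re - 2 * ∑ k, (P.lam i k k x).re)
    (fun i x => -4 * m * (P.alpha i x).im - 2 * ∑ k, (P.lam i k k x).im)

theorem continuous_driftCoeff (m : ℕ) (s : Fin n ⊕ Fin n) : Continuous (P.driftCoeff m s) := by
  have hα := P.continuous_alpha
  have hlam := P.continuous_lam
  rcases s with i | i <;> simp only [driftCoeff, Sum.elim_inl, Sum.elim_inr]
  · exact (continuous_const.mul (Complex.continuous_re.comp (hα i))).sub (continuous_const.mul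
      (continuous_finsetSum _ fun k _ => Complex.continuous_re.comp (hlam i k k)))
  · exact (continuous_const.mul (Complex.continuous_im.comp (hα i))).sub (continuous_const.mul
      (continuous_finsetSum _ fun k _ => Complex.continuous_im.comp (hlam i k k)))

omit [FiniteDimensional ℝ E] in
theorem L_eq_sumSq (m : ℕ) (f : M → ℝ) :
    P.L m f = sumSq I (Sum.elim P.v P.w) (P.driftCoeff m) f := by
  funext x
  simp only [L, sumSq, driftCoeff, Fintype.sum_sum_type, Sum.elim_inl, Sum.elim_inr, sub_mul,
    Finset.sum_add_distrib, Finset.sum_sub_distrib, Finset.sum_mul, Finset.mul_sum]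
  -- In `L` the sum over `k` is outermost; the drift along `v i` and `w i` collects `λⁱₖₖ` over `k`.
  rw [Finset.sum_comm (f := fun k i => 2 * ((P.lam i k k x).re * dirDeriv I (P.v i) f x)),
    Finset.sum_comm (f := fun k i => 2 * ((P.lam i k k x).im * dirDeriv I (P.w i) f x))]
  simp only [neg_mul, Finset.sum_neg_distrib, mul_assoc]
  ring

end AdaptedParallelism

end AlmostComplexPDE

end

/-! ### Decoupling of the system and conclusion -/

theorem mainTheorem3 {n : ℕ} {M : Type*} [TopologicalSpace M] [T2Space M]
    [ChartedSpace (EuclideanSpace ℝ (Fin (2 * n))) M] [IsManifold (𝓡 (2 * n)) ∞ M]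
    [CompactSpace M] [ConnectedSpace M]
    (𝒥 : AlmostComplexPDE.AlmostComplexStructure (𝓡 (2 * n)) M)
    (P : AlmostComplexPDE.AdaptedParallelism 𝒥 n)
    (m : ℕ) (hm : 1 ≤ m)
    (hβ : ∀ x, (P.beta x).im = 0)
    (hα : ∀ x, (m : ℝ) * ∑ k, ‖P.alpha k x‖ ^ 2 ≤
      (∑ k, (P.cX k (P.alpha k) x - ∑ i, P.lam i k k x * starRingEnd ℂ (P.alpha i x))).re)
    (u v : M → ℝ) (hu : ContMDiff (𝓡 (2 * n)) 𝓘(ℝ, ℝ) 2 u)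
    (hv : ContMDiff (𝓡 (2 * n)) 𝓘(ℝ, ℝ) 2 v)
    (huv : P.IsSolution m u v) :
    (∃ a : ℝ, ∀ x, u x = a) ∧ (∃ b : ℝ, ∀ x, v x = b) := by
  -- The maximum principle needs only a `C^2` atlas.
  have : IsManifold (𝓡 (2 * n)) 2 M := .of_le (n := ∞) (by norm_cast)
  have hq (x : M) : 0 ≤ P.zerothCoeff m x := by
    have h := hα x
    simp only [AlmostComplexPDE.AdaptedParallelism.zerothCoeff, Finset.mul_sum, Finset.sum_sub_distrib,
      Complex.sub_re, Complex.re_sum, Complex.re_mul_ofReal, Complex.natCast_re] at h ⊢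
    linarith
  have hX (i : Fin n ⊕ Fin n) (x : M) :=
    (P.isFrame.contMDiffAt isOpen_univ (Set.mem_univ x) i).of_le (n := ∞) (m := 1) (by simp)
  have key (f : M → ℝ) (hf : ContMDiff (𝓡 (2 * n)) 𝓘(ℝ, ℝ) 2 f)
      (hLf : ∀ x, P.L m f x = 4 * m * P.zerothCoeff m x * f x) : ∃ a : ℝ, ∀ x, f x = a := by
    rw [P.L_eq_sumSq] at hLf
    refine AlmostComplexPDE.eq_const_of_sumSq_eq_mul hX
      (fun x => P.isFrame.generating (Set.mem_univ x)) (P.continuous_driftCoeff m) hf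
      (fun x => ?_) hLf
    have := hq x
    positivity
  refine ⟨key u hu fun x => ?_, key v hv fun x => ?_⟩
  · have h := (huv x).2
    rw [hβ x] at h
    linarith
  · have h := (huv x).1
    rw [hβ x] at h
    linarith
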